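/- Let $n\ge 5$ and let $\pi=(d_1,d_2,\dots,d_n)$ be a non-increasing sequence of positive integers that is graphic, i.e. the degree sequence of some (finite) simple graph on $n$ vertices; such a graph is called a realization of $\pi$. Let $K_5-K_{1,3}$ denote the graph obtained from the complete graph $K_5$ by removing the three edges of a star $K_{1,3}$ contained in it. Then $\pi$ has a realization containing $K_5-K_{1,3}$ as a (not necessarily induced) subgraph if and only if both of the following conditions hold, where $r^t$ means that the term $r$ is repeated $t$ times: (1) $d_1\ge 4$ and $d_4\ge 3$; (2) $\pi$ is none of the sequences $(4,3^4,2)$, $(4^6)$, $(4^2,3^4)$, $(4,3^6)$, $(4^7)$, $(4,3^5,1)$, $(n-1,3^4,1^{n-5})$, and (for $n\ge 6$) $(n-1,3^5,1^{n-6})$. -/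

import Mathlib

open scoped SimpleGraph

open Classical in
/-- The simple graph `G` on the vertices `v_1, …, v_n` (indexed by `Fin n`) is a realization of the
sequence `d = (d_1, …, d_n)`: the vertex `v_i` has degree `d_i`. -/
def IsRealization {n : ℕ} (G : SimpleGraph (Fin n)) (d : Fin n → ℕ) : Prop :=
  ∀ i, G.degree i = d i

/-- A sequence is graphic if it is the degree sequence of a simple graph of order `n`. -/
def IsGraphic {n : ℕ} (d : Fin n → ℕ) : Prop :=
  ∃ G : SimpleGraph (Fin n), IsRealization G d

/-- A sequence is potentially `H`-graphic if it has a realization containing `H` as a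
(not necessarily induced) subgraph. -/
def IsPotentiallyGraphic {V : Type*} (H : SimpleGraph V) {n : ℕ} (d : Fin n → ℕ) : Prop :=
  ∃ G : SimpleGraph (Fin n), IsRealization G d ∧ H ⊑ G

/-- `K_5 - K_{1,3}`: the complete graph on `{0, 1, 2, 3, 4}` with the three edges of a star
`K_{1,3}` (centre `0`, leaves `1, 2, 3`) removed. -/
def K5MinusK13 : SimpleGraph (Fin 5) :=
  (⊤ : SimpleGraph (Fin 5)).deleteEdges {s(0, 1), s(0, 2), s(0, 3)}

/-!
If a realization contains `K₄` and some vertex has degree at least four, then by an exchange of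
neighbours there is a realization in which some vertex of a `K₄` has a neighbour outside it; such a
`K₄` and this neighbour span a graph containing `K₅ - K₁,₃`. So the question is which sequences have
a realization containing `K₄`, and a theorem of Luo and Warner answers it: those with at least four
terms `≥ 3`, except for finitely many sporadic sequences and the two families
`(s + j, 3^s, 1^j)`, `s = 4, 5`.

The exceptional sequences violate an Erdős–Gallai type inequality for graphs with a prescribed
clique, or reduce to one that does. Conversely, lay off a smallest term `k` by subtracting one from
`k` largest other terms. By Havel and Hakimi the shorter sequence is graphic, and a realization of
it containing `K₄` extends by a vertex of degree `k`. By induction it remains to treat the sequences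
that lose their fourth term `≥ 3` in this step and those that become exceptional. The former are
short, or have nearly all terms at most `3` and are realized by explicit graphs; the latter are
again exceptional or belong to a finite list.
-/

namespace DegreeSequence

open Finset SimpleGraph

section Exchange

open scoped Classical

variable {V : Type*} {G : SimpleGraph V} {x y : V} {S : Finset V}

/-- The graph in which `x` and `y` have exchanged their adjacencies to the vertices of `S`. It is
meant for sets `S` that contain neither `x` nor `y`. -/
def exchange (G : SimpleGraph V) (x y : V) (S : Finset V) : SimpleGraph V where
  Adj a b := G.Adj (if b ∈ S then Equiv.swap x y a else a) (if a ∈ S then Equiv.swap x y b else b)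
  symm := ⟨fun _ _ h => h.symm⟩
  loopless := ⟨fun _ h => h.ne rfl⟩

theorem exchange_adj {a b : V} : (exchange G x y S).Adj a b ↔
    G.Adj (if b ∈ S then Equiv.swap x y a else a) (if a ∈ S then Equiv.swap x y b else b) :=
  Iff.rfl

theorem exchange_adj_of_ne {a b : V} (hax : a ≠ x) (hay : a ≠ y) (hbx : b ≠ x) (hby : b ≠ y) :
    (exchange G x y S).Adj a b ↔ G.Adj a b := by
  simp only [exchange_adj, Equiv.swap_apply_of_ne_of_ne, ne_eq, not_false_eq_true, ite_self, *]

theorem exchange_comm (G : SimpleGraph V) (x y : V) (S : Finset V) :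
    exchange G x y S = exchange G y x S := by
  simp only [exchange, Equiv.swap_comm]

variable [Fintype V]

theorem neighborFinset_exchange_left (hx : x ∉ S) :
    (exchange G x y S).neighborFinset x =
      G.neighborFinset y ∩ S ∪ G.neighborFinset x \ S := by
  ext b
  by_cases hb : b ∈ S <;> simp [mem_neighborFinset, exchange_adj, hx, hb]

theorem neighborFinset_exchange_of_mem (hx : x ∉ S) (hy : y ∉ S) {w : V} (hw : w ∈ S) :
    (exchange G x y S).neighborFinset w =
      (G.neighborFinset w).map (Equiv.swap x y).toEmbedding := by
  have hwx : Equiv.swap x y w = w :=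
    Equiv.swap_apply_of_ne_of_ne (ne_of_mem_of_not_mem hw hx) (ne_of_mem_of_not_mem hw hy)
  ext b
  simp [mem_neighborFinset, exchange_adj, hw, hwx, mem_map_equiv]

theorem degree_exchange (hx : x ∉ S) (hy : y ∉ S)
    (h : #(G.neighborFinset x ∩ S) = #(G.neighborFinset y ∩ S)) (w : V) :
    (exchange G x y S).degree w = G.degree w := by
  have degree_left {x y : V} (hx : x ∉ S)
      (h : #(G.neighborFinset x ∩ S) = #(G.neighborFinset y ∩ S)) :
      (exchange G x y S).degree x = G.degree x := by
    rw [← card_neighborFinset_eq_degree, neighborFinset_exchange_left hx,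
      card_union_of_disjoint (disjoint_sdiff.mono_left inter_subset_right), ← h, add_comm,
      card_sdiff_add_card_inter, card_neighborFinset_eq_degree]
  by_cases hwx : w = x
  · subst hwx
    exact degree_left hx h
  by_cases hwy : w = y
  · subst hwy
    rw [exchange_comm]
    exact degree_left hy h.symm
  by_cases hw : w ∈ S
  · rw [← card_neighborFinset_eq_degree, neighborFinset_exchange_of_mem hx hy hw, card_map,
      card_neighborFinset_eq_degree]
  · refine congrArg card ?_
    ext b
    simp [mem_neighborFinset, exchange_adj, hw, Equiv.swap_apply_of_ne_of_ne hwx hwy]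

/-- In the graph obtained, `x` is adjacent to all former neighbours of `y`: it receives those it
lacks and hands over as many of its own, which exist since `y` has the smaller degree. -/
theorem exists_degree_eq_forall_adj (h : G.degree y ≤ G.degree x) :
    ∃ G' : SimpleGraph V, (∀ w, G'.degree w = G.degree w) ∧
      (∀ a, G.Adj y a → a ≠ x → G'.Adj x a) ∧
      ∀ a b, a ≠ x → a ≠ y → b ≠ x → b ≠ y → (G'.Adj a b ↔ G.Adj a b) := by
  set P := (G.neighborFinset y \ G.neighborFinset x).erase x with hP
  have hcard : #P ≤ #((G.neighborFinset x \ G.neighborFinset y).erase y) := by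
    have := card_sdiff_le_card_sdiff_iff.mpr h
    simp only [hP, card_erase_eq_ite, mem_sdiff, mem_neighborFinset, G.adj_comm y x,
      G.loopless.irrefl]
    grind
  obtain ⟨Q, hQ, hQP⟩ := exists_subset_card_eq hcard
  have mem_P {a : V} : a ∈ P ↔ a ≠ x ∧ G.Adj y a ∧ ¬ G.Adj x a := by simp [hP]
  have mem_Q {a : V} (ha : a ∈ Q) : a ≠ y ∧ G.Adj x a ∧ ¬ G.Adj y a := by simpa using hQ ha
  have hx : x ∉ P ∪ Q := by grind [G.loopless.irrefl x]
  have hy : y ∉ P ∪ Q := by grind [G.loopless.irrefl y]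
  have hNx : G.neighborFinset x ∩ (P ∪ Q) = Q := by ext a; grind [mem_neighborFinset]
  have hNy : G.neighborFinset y ∩ (P ∪ Q) = P := by ext a; grind [mem_neighborFinset]
  refine ⟨exchange G x y (P ∪ Q), degree_exchange hx hy (by rw [hNx, hNy, hQP]),
    fun a hya hax => ?_, fun a b => exchange_adj_of_ne⟩
  rw [← mem_neighborFinset, neighborFinset_exchange_left hx, hNy]
  grind [mem_neighborFinset]

theorem exists_neighborFinset_eq {v : V} (hv : v ∉ S) (hcard : #S = G.degree v)
    (hS : ∀ a ∈ S, ∀ b ∉ S, b ≠ v → G.degree b ≤ G.degree a) :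
    ∃ G' : SimpleGraph V, (∀ w, G'.degree w = G.degree w) ∧ G'.neighborFinset v = S := by
  induction hk : #(S \ G.neighborFinset v) using Nat.strong_induction_on generalizing G with
  | _ k ih =>
  by_cases hsub : S ⊆ G.neighborFinset v
  · exact ⟨G, fun _ => rfl, (eq_of_subset_of_card_le hsub hcard.ge).symm⟩
  obtain ⟨x, hxS, hvx⟩ := not_subset.mp hsub
  obtain ⟨y, hvy, hyS⟩ : ∃ y ∈ G.neighborFinset v, y ∉ S := not_subset.mp fun hsub' =>
    hsub (eq_of_subset_of_card_le hsub' hcard.le).ge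
  rw [mem_neighborFinset] at hvx hvy
  have hvx' : v ≠ x := (ne_of_mem_of_not_mem hxS hv).symm
  obtain ⟨G₁, hdeg, hadj, hrest⟩ := exists_degree_eq_forall_adj (hS x hxS y hyS hvy.ne')
  have hlt : #(S \ G₁.neighborFinset v) < k := by
    rw [← hk]
    refine card_lt_card ⟨fun b hb => ?_, fun hsub' => ?_⟩
    · simp only [mem_sdiff, mem_neighborFinset] at hb ⊢
      have hbx : b ≠ x := fun hbx => hb.2 (hbx ▸ (hadj v hvy.symm hvx').symm)
      exact ⟨hb.1, fun hvb => hb.2 <|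
        (hrest v b hvx' hvy.ne hbx (ne_of_mem_of_not_mem hb.1 hyS)).mpr hvb⟩
    · have := hsub' (mem_sdiff.mpr ⟨hxS, by simpa using hvx⟩)
      exact (mem_sdiff.mp this).2 (by simpa using (hadj v hvy.symm hvx').symm)
  obtain ⟨G', hdeg', hG'⟩ := ih _ hlt (by rw [hcard, hdeg]) (by simpa only [hdeg] using hS) rfl
  exact ⟨G', fun w => (hdeg' w).trans (hdeg w), hG'⟩

theorem exists_isNClique_insert_erase {r : ℕ} {A : Finset V} (hA : G.IsNClique r A) {u e : V}
    (hu : u ∉ A) (he : e ∈ A) (h : G.degree e ≤ G.degree u) :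
    ∃ G' : SimpleGraph V, (∀ w, G'.degree w = G.degree w) ∧
      G'.IsNClique r (insert u (A.erase e)) := by
  obtain ⟨G', hdeg, hadj, hrest⟩ := exists_degree_eq_forall_adj h
  have hne {a : V} (ha : a ∈ A.erase e) : a ≠ u ∧ a ≠ e :=
    ⟨ne_of_mem_of_not_mem (mem_of_mem_erase ha) hu, ne_of_mem_erase ha⟩
  have hclique : G'.IsNClique (r - 1) (A.erase e) := by
    refine ⟨fun a ha b hb hab => ?_, (hA.erase_of_mem he).card_eq⟩
    exact (hrest a b (hne ha).1 (hne ha).2 (hne hb).1 (hne hb).2).mpr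
      ((hA.erase_of_mem he).isClique ha hb hab)
  have hr : r - 1 + 1 = r := Nat.sub_add_cancel (hA.card_eq ▸ card_pos.mpr ⟨e, he⟩)
  refine ⟨G', hdeg, hr ▸ hclique.insert fun a ha => hadj a ?_ (hne ha).1⟩
  exact hA.isClique he (mem_of_mem_erase ha) (hne ha).2.symm

end Exchange

section PotentiallyGraphic

open scoped Classical

variable {V V' W W' : Type*} {H : SimpleGraph W} {M : Multiset ℕ}

/-- Some realization of the degree multiset `M` contains `H` as a subgraph. The vertices of the
realization are the terms of `M`, counted with multiplicity. -/
def PotentiallyGraphic (H : SimpleGraph W) (M : Multiset ℕ) : Prop :=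
  ∃ G : SimpleGraph M, (∀ v : M, G.degree v = v.1) ∧ H ⊑ G

/-- Some graph has the degree multiset `M`: the case of the empty subgraph. -/
abbrev Graphic (M : Multiset ℕ) : Prop :=
  PotentiallyGraphic (⊥ : SimpleGraph Empty) M

theorem exists_equiv_of_map_univ_eq [Fintype V] [Fintype V'] {α : Type*} {f : V → α} {g : V' → α}
    (h : univ.val.map f = univ.val.map g) : ∃ e : V ≃ V', ∀ v, g (e v) = f v := by
  have hfib (k : α) : Nonempty ({v // f v = k} ≃ {v // g v = k}) := by
    refine ⟨Fintype.equivOfCardEq ?_⟩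
    have := congrArg (Multiset.count k) h
    simp only [Multiset.count_map, ← filter_val, card_val] at this
    simpa only [Fintype.card_subtype, eq_comm] using this
  exact ⟨Equiv.ofFiberEquiv fun k => (hfib k).some, Equiv.ofFiberEquiv_map _⟩

theorem potentiallyGraphic_map [Fintype V] {f : V → ℕ} :
    PotentiallyGraphic H (univ.val.map f) ↔
      ∃ G : SimpleGraph V, (∀ v, G.degree v = f v) ∧ H ⊑ G := by
  obtain ⟨e, he⟩ := exists_equiv_of_map_univ_eq
    ((univ.val.map f).map_univ_coe.symm : univ.val.map f = _)
  constructor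
  · rintro ⟨G, hdeg, hG⟩
    refine ⟨G.comap e, fun v => ?_, hG.trans (Iso.comap e G).symm.isContained⟩
    rw [← he, ← hdeg, ← (Iso.comap e G).degree_eq]
    rfl
  · rintro ⟨G, hdeg, hG⟩
    refine ⟨G.comap e.symm, fun v => ?_, hG.trans (Iso.comap e.symm G).symm.isContained⟩
    have hv : f (e.symm v) = v.1 := by rw [← he, e.apply_symm_apply]
    rw [← hv, ← hdeg, ← (Iso.comap e.symm G).degree_eq]
    rfl

theorem PotentiallyGraphic.mono {H' : SimpleGraph W'} (hH : H' ⊑ H) :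
    PotentiallyGraphic H M → PotentiallyGraphic H' M
  | ⟨G, hdeg, hG⟩ => ⟨G, hdeg, hH.trans hG⟩

theorem Graphic.even_sum : Graphic M → Even M.sum
  | ⟨G, hdeg, _⟩ => by
    rw [Multiset.sum_eq_sum_coe, ← sum_congr rfl fun v _ => hdeg v,
      G.sum_degrees_eq_twice_card_edges]
    exact even_two_mul _

theorem Graphic.lt_card {x : ℕ} (hx : x ∈ M) : Graphic M → x < M.card
  | ⟨G, hdeg, _⟩ => by
    have hlt := G.degree_lt_card_verts (M.mkToType x ⟨0, Multiset.count_pos.mpr hx⟩)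
    rwa [hdeg, M.card_coe] at hlt

end PotentiallyGraphic

section Extend

open scoped Classical

variable {V W : Type*} {H : SimpleGraph W} {T R : Multiset ℕ}

/-- The graph obtained by adding a vertex `none` with neighbourhood `S`. -/
def addVertex (G : SimpleGraph V) (S : Set V) : SimpleGraph (Option V) where
  Adj
    | some a, some b => G.Adj a b
    | none, some b => b ∈ S
    | some a, none => a ∈ S
    | none, none => False
  symm := ⟨by rintro (_ | a) (_ | b) h <;> first | exact h | exact h.symm⟩
  loopless := ⟨by rintro (_ | a) h; exacts [h, G.loopless.irrefl a h]⟩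

theorem comap_some_addVertex (G : SimpleGraph V) (S : Set V) :
    (addVertex G S).comap some = G :=
  rfl

theorem addVertex_adj_none_some {G : SimpleGraph V} {S : Set V} {v : V} :
    (addVertex G S).Adj none (some v) ↔ v ∈ S :=
  Iff.rfl

theorem degree_some [Fintype V] {G : SimpleGraph (Option V)} {G₀ : SimpleGraph V}
    (hG : G.comap some = G₀) (v : V) :
    G.degree (some v) = G₀.degree v + if G.Adj none (some v) then 1 else 0 := by
  have hN : G.neighborFinset (some v) = (G₀.neighborFinset v).map .some ∪
      if G.Adj none (some v) then {none} else ∅ := by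
    ext (_ | b) <;> split_ifs <;> simp_all [← hG, G.adj_comm (some v) none]
  rw [← card_neighborFinset_eq_degree, hN, card_union_of_disjoint, card_map,
    card_neighborFinset_eq_degree]
  · split_ifs <;> rfl
  · split_ifs <;> simp

/-- The degree multiset obtained from `T + R` by adding a vertex whose neighbours have the degrees
in `T`. -/
def extend (T R : Multiset ℕ) : Multiset ℕ := {T.card} + (T.map (· + 1) + R)

theorem map_univ_sumElim (T R : Multiset ℕ) :
    (univ.val.map (Sum.elim (fun t : T => t.1) fun r : R => r.1)) = T + R := by
  rw [show (univ : Finset (T ⊕ R)).val = univ.val.map Sum.inl + univ.val.map Sum.inr from rfl]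
  simp

/-- The degrees of the vertices of a graph on `Option (T ⊕ R)` obtained by adding to a graph with
degree multiset `T + R` a vertex adjacent to the vertices in `T`. -/
def extendDegree (T R : Multiset ℕ) : Option (T ⊕ R) → ℕ
  | none => T.card
  | some (.inl t) => t + 1
  | some (.inr r) => r

theorem map_univ_extendDegree (T R : Multiset ℕ) :
    univ.val.map (extendDegree T R) = extend T R := by
  rw [show (univ : Finset (Option (T ⊕ R))).val =
    none ::ₘ (univ.val.map Sum.inl + univ.val.map Sum.inr).map some from rfl]
  simp [extendDegree, extend, ← Multiset.map_univ T, Function.comp_def]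

theorem potentiallyGraphic_extend (h : PotentiallyGraphic H (T + R)) :
    PotentiallyGraphic H (extend T R) := by
  rw [← map_univ_sumElim, potentiallyGraphic_map] at h
  obtain ⟨G, hdeg, hG⟩ := h
  rw [← map_univ_extendDegree, potentiallyGraphic_map]
  have hsub : G ⊑ addVertex G (Set.range Sum.inl) :=
    ⟨⟨some, id⟩, Option.some_injective _⟩
  refine ⟨addVertex G (Set.range Sum.inl), ?_, hG.trans hsub⟩
  rintro (_ | t | r)
  · have hN : (addVertex G (Set.range (Sum.inl : T → T ⊕ R))).neighborFinset none =
        univ.map (Function.Embedding.inl.trans .some) := by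
      ext (_ | _ | _) <;> simp [mem_neighborFinset, addVertex_adj_none_some]
    rw [← card_neighborFinset_eq_degree, hN]
    simp [extendDegree]
  · simp [degree_some (comap_some_addVertex G _), hdeg, extendDegree, addVertex_adj_none_some]
  · simp [degree_some (comap_some_addVertex G _), hdeg, extendDegree, addVertex_adj_none_some]

/-- The reduction of Havel–Hakimi and Kleitman–Wang: by `exists_neighborFinset_eq`, the neighbours
of the vertex that is removed may be taken to be the vertices in `T`. -/
theorem Graphic.of_extend (h : Graphic (extend T R)) (hTR : ∀ t ∈ T, ∀ r ∈ R, r ≤ t + 1) :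
    Graphic (T + R) := by
  rw [← map_univ_extendDegree, Graphic, potentiallyGraphic_map] at h
  obtain ⟨G, hdeg, -⟩ := h
  let S : Finset (Option (T ⊕ R)) := univ.map (Function.Embedding.inl.trans .some)
  have hS : ∀ a ∈ S, ∀ b ∉ S, b ≠ none → G.degree b ≤ G.degree a := by
    rintro (_ | t | _) ha (_ | _ | r) hb hbn <;>
      simp_all [S, extendDegree]
  obtain ⟨G', hdeg', hN⟩ := exists_neighborFinset_eq (G := G) (v := none) (S := S) (by simp [S])
    (by simp [S, hdeg, extendDegree]) hS
  have hadj (b : Option (T ⊕ R)) : G'.Adj none b ↔ b ∈ S := by rw [← hN, mem_neighborFinset]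
  rw [← map_univ_sumElim, Graphic, potentiallyGraphic_map]
  refine ⟨G'.comap some, ?_, .of_isEmpty⟩
  rintro (t | r)
  · simpa [hdeg', hdeg, extendDegree, hadj, S] using (degree_some (G := G') rfl (.inl t)).symm
  · simpa [hdeg', hdeg, extendDegree, hadj, S] using (degree_some (G := G') rfl (.inr r)).symm

end Extend

section Clique

open scoped Classical

variable {V : Type*} {G : SimpleGraph V} {A B : Finset V} {r : ℕ} {M : Multiset ℕ}

theorem exists_isNClique_of_top_isContained (h : (⊤ : SimpleGraph (Fin r)) ⊑ G) :
    ∃ A, G.IsNClique r A := by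
  simpa [CliqueFree] using (not_cliqueFree_iff_top_isContained r).mpr h

variable [Fintype V]

theorem isNClique_erase_subset_neighborFinset (hA : G.IsNClique r A) {a : V} (ha : a ∈ A) :
    A.erase a ⊆ G.neighborFinset a := fun _ hb =>
  (mem_neighborFinset ..).mpr (hA.isClique ha (mem_of_mem_erase hb) (ne_of_mem_erase hb).symm)

theorem isNClique_le_degree (hA : G.IsNClique r A) {a : V} (ha : a ∈ A) : r - 1 ≤ G.degree a := by
  rw [← (hA.erase_of_mem ha).card_eq]
  exact card_le_card (isNClique_erase_subset_neighborFinset hA ha)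

theorem isNClique_card_neighborFinset_inter_le (hA : G.IsNClique r A) (hAB : Disjoint A B) {a : V}
    (ha : a ∈ A) : #(G.neighborFinset a ∩ B) ≤ G.degree a - (r - 1) := by
  have hsub : G.neighborFinset a ∩ B ⊆ G.neighborFinset a \ A.erase a := fun b hb =>
    mem_sdiff.mpr ⟨(mem_inter.mp hb).1, fun hbA =>
      Finset.disjoint_left.mp hAB (mem_of_mem_erase hbA) (mem_inter.mp hb).2⟩
  calc #(G.neighborFinset a ∩ B) ≤ #(G.neighborFinset a \ A.erase a) := card_le_card hsub
    _ = G.degree a - (r - 1) := by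
      rw [card_sdiff_of_subset (isNClique_erase_subset_neighborFinset hA ha),
        (hA.erase_of_mem ha).card_eq, card_neighborFinset_eq_degree]

theorem sum_degree_le (G : SimpleGraph V) (B : Finset V) :
    ∑ b ∈ B, G.degree b ≤ #B * (#B - 1) + ∑ c ∈ Bᶜ, #(G.neighborFinset c ∩ B) := by
  have hsplit (b : V) : G.degree b = #(G.neighborFinset b ∩ B) + #(G.neighborFinset b ∩ Bᶜ) := by
    rw [← sdiff_eq_inter_compl, add_comm, card_sdiff_add_card_inter, card_neighborFinset_eq_degree]
  have hinner : ∑ b ∈ B, #(G.neighborFinset b ∩ B) ≤ #B * (#B - 1) := by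
    refine (sum_le_card_nsmul B _ (#B - 1) fun b hb => ?_).trans_eq (smul_eq_mul ..)
    rw [← card_erase_of_mem hb]
    exact card_le_card fun c hc => by simp_all [G.adj_comm b c, G.ne_of_adj]
  have houter : ∑ b ∈ B, #(G.neighborFinset b ∩ Bᶜ) = ∑ c ∈ Bᶜ, #(G.neighborFinset c ∩ B) := by
    convert sum_card_bipartiteAbove_eq_sum_card_bipartiteBelow (s := B) (t := Bᶜ) G.Adj using 4 <;>
      ext <;> simp [bipartiteAbove, bipartiteBelow, G.adj_comm, and_comm]
  rw [sum_congr rfl fun b _ => hsplit b, sum_add_distrib, houter]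
  gcongr

theorem isNClique_sum_degree_le (hA : G.IsNClique r A) (hAB : Disjoint A B) :
    ∑ b ∈ B, G.degree b ≤
      #B * (#B - 1) + ∑ c ∈ Aᶜ \ B, G.degree c + ∑ a ∈ A, (G.degree a - (r - 1)) := by
  have hcompl : Bᶜ = (Aᶜ \ B).disjUnion A (disjoint_compl_left.mono_left sdiff_subset) := by
    ext v
    have hv : v ∈ A → v ∉ B := fun hv => Finset.disjoint_left.mp hAB hv
    simp only [mem_compl, mem_disjUnion, mem_sdiff]
    tauto
  refine (sum_degree_le G B).trans ?_
  rw [hcompl, sum_disjUnion, ← add_assoc]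
  gcongr with c _ a ha
  · exact card_le_card inter_subset_left
  · exact isNClique_card_neighborFinset_inter_le hA hAB ha

/-- If `A` lists the degrees of the vertices of an `r`-clique and `N` those of the other vertices,
this inequality bounds the sum of the terms of `N` that satisfy `p`, by counting the edges from the
corresponding vertices to each other, to the rest of `N`, and to the clique. -/
abbrev CliqueInequality (r : ℕ) (A N : Multiset ℕ) (p : ℕ → Prop) [DecidablePred p] : Prop :=
  (N.filter p).sum ≤
    (N.filter p).card * ((N.filter p).card - 1) + (N.filter (¬ p ·)).sum +
      (A.map (· - (r - 1))).sum

theorem PotentiallyGraphic.exists_cliqueInequality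
    (h : PotentiallyGraphic (⊤ : SimpleGraph (Fin r)) M) :
    ∃ A ≤ M, A.card = r ∧ (∀ a ∈ A, r - 1 ≤ a) ∧
      ∀ (p : ℕ → Prop) [DecidablePred p], CliqueInequality r A (M - A) p := by
  obtain ⟨G, hG₀, hG⟩ := h
  obtain ⟨f, hM, hdeg⟩ : ∃ f : M → ℕ, M = univ.val.map f ∧ ∀ v, G.degree v = f v :=
    ⟨_, M.map_univ_coe.symm, hG₀⟩
  obtain ⟨A, hA⟩ := exists_isNClique_of_top_isContained hG
  have hsplit : M = A.val.map f + Aᶜ.val.map f := by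
    rw [← Multiset.map_add, compl_eq_univ_sdiff, sdiff_val,
      add_tsub_cancel_of_le (val_le_iff.mpr (subset_univ A)), ← hM]
  refine ⟨A.val.map f, le_iff_exists_add.mpr ⟨_, hsplit⟩, by simpa using hA.card_eq, ?_,
    fun p _ => ?_⟩
  · simp only [← hdeg, Multiset.mem_map, forall_exists_index, and_imp, forall_apply_eq_imp_iff₂]
    exact fun a => isNClique_le_degree hA
  · have hle := isNClique_sum_degree_le hA
      (disjoint_compl_right.mono_right (filter_subset (fun v => p (f v)) Aᶜ))
    rw [← filter_not] at hle
    simp only [Finset.sum, hdeg] at hle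
    simp only [CliqueInequality, tsub_eq_of_eq_add_rev hsplit, Multiset.filter_map,
      Multiset.card_map, Multiset.map_map]
    exact hle

theorem K5MinusK13_isContained (hA : G.IsNClique 4 A) {a : V} (ha : a ∈ A)
    (hdeg : 4 ≤ G.degree a) : K5MinusK13 ⊑ G := by
  obtain ⟨x, hax, hxA⟩ := exists_mem_notMem_of_card_lt_card
    (show #(A.erase a) < #(G.neighborFinset a) by
      rw [(hA.erase_of_mem ha).card_eq, card_neighborFinset_eq_degree]; omega)
  obtain ⟨b, c, e, hbc, hbe, hce, hbce⟩ := is3Clique_iff.mp (hA.erase_of_mem ha)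
  obtain ⟨hab, hac, hae⟩ : G.Adj a b ∧ G.Adj a c ∧ G.Adj a e := by
    have := isNClique_erase_subset_neighborFinset hA ha
    simpa [hbce, insert_subset_iff] using this
  rw [mem_neighborFinset] at hax
  have hx : x ≠ b ∧ x ≠ c ∧ x ≠ e := by simpa [hbce] using hxA
  let f : Fin 5 → V := ![x, b, c, e, a]
  refine ⟨⟨f, fun {i j} hij => ?_⟩, fun i j hij => ?_⟩
  · revert i j
    simp [Fin.forall_fin_succ, K5MinusK13, f, G.adj_comm, *]
  · have hnodup : (List.ofFn f).Nodup := by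
      change [x, b, c, e, a].Nodup
      grind [G.ne_of_adj hax, G.ne_of_adj hab, G.ne_of_adj hac, G.ne_of_adj hae, G.ne_of_adj hbc,
        G.ne_of_adj hbe, G.ne_of_adj hce]
    exact List.nodup_ofFn.mp hnodup hij

theorem top_isContained_K5MinusK13 : (⊤ : SimpleGraph (Fin 4)) ⊑ K5MinusK13 := by
  refine ⟨⟨Fin.succ, fun {i j} hij => ?_⟩, Fin.succ_injective 4⟩
  rw [K5MinusK13, deleteEdges_adj]
  revert i j
  decide

theorem degree_K5MinusK13_four : K5MinusK13.degree 4 = 4 := by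
  have hN : K5MinusK13.neighborFinset 4 = {4}ᶜ := by
    ext i
    rw [mem_neighborFinset, K5MinusK13, deleteEdges_adj]
    revert i
    decide
  rw [← card_neighborFinset_eq_degree, hN]
  rfl

/-- If all vertices of the `K₄` have degree three, then a vertex of degree at least four outside
it can take the place of any of them. -/
theorem potentiallyGraphic_K5MinusK13_iff :
    PotentiallyGraphic K5MinusK13 M ↔
      PotentiallyGraphic (⊤ : SimpleGraph (Fin 4)) M ∧ ∃ x ∈ M, 4 ≤ x := by
  constructor
  · intro h
    refine ⟨h.mono top_isContained_K5MinusK13, ?_⟩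
    obtain ⟨G, hdeg, ⟨f⟩⟩ := h
    refine ⟨(f 4).1, Multiset.coe_mem, ?_⟩
    exact (degree_K5MinusK13_four.symm.trans_le (f.degree_le 4)).trans_eq (hdeg _)
  · rintro ⟨⟨G, hdeg, hG⟩, x, hx, hx4⟩
    obtain ⟨A, hA⟩ := exists_isNClique_of_top_isContained hG
    obtain ⟨u, hu⟩ : ∃ u, 4 ≤ G.degree u :=
      ⟨M.mkToType x ⟨0, Multiset.count_pos.mpr hx⟩, by rwa [hdeg]⟩
    by_cases hA4 : ∃ a ∈ A, 4 ≤ G.degree a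
    · obtain ⟨a, ha, ha4⟩ := hA4
      exact ⟨G, hdeg, K5MinusK13_isContained hA ha ha4⟩
    push Not at hA4
    obtain ⟨e, he⟩ : A.Nonempty := card_pos.mp (hA.card_eq ▸ Nat.succ_pos 3)
    obtain ⟨G', hdeg', hA'⟩ := exists_isNClique_insert_erase hA (fun huA => (hA4 u huA).not_ge hu)
      he ((hA4 e he).le.trans hu)
    exact ⟨G', fun v => (hdeg' v).trans (hdeg v),
      K5MinusK13_isContained hA' (mem_insert_self ..) (hu.trans_eq (hdeg' u).symm)⟩

end Clique

section Exceptional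

/-- The exceptional sequences outside the families `wheelLike 4` and `wheelLike 5`. -/
def sporadic : List (List ℕ) :=
  [[3, 3, 3, 3, 2], [4, 4, 4, 4, 4, 4], [4, 4, 3, 3, 3, 3], [4, 3, 3, 3, 3, 2], [3, 3, 3, 3, 3, 3],
   [3, 3, 3, 3, 3, 1], [3, 3, 3, 3, 2, 2], [4, 4, 4, 4, 4, 4, 4], [4, 3, 3, 3, 3, 3, 3],
   [4, 3, 3, 3, 3, 3, 1], [3, 3, 3, 3, 3, 3, 2], [3, 3, 3, 3, 3, 2, 1], [3, 3, 3, 3, 3, 3, 3, 1],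
   [3, 3, 3, 3, 3, 3, 1, 1]]

/-- The sequence `(s + j, 3^s, 1^j)`: the degrees of a wheel with `s` spokes and `j` pendant edges
attached to its hub. -/
def wheelLike (s j : ℕ) : Multiset ℕ := {s + j} + (s • {3} + j • {1})

/-- The multisets that are exceptional in the theorem of Luo and Warner on the degree sequences of
graphs containing `K₄`. -/
def Exceptional (M : Multiset ℕ) : Prop :=
  (∃ l ∈ sporadic, M = l) ∨ ∃ j, M = wheelLike 4 j ∨ M = wheelLike 5 j

theorem wheelLike_eq_extend (s j : ℕ) : wheelLike s j = extend (s • {2} + j • {0}) 0 := by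
  simp [wheelLike, extend, Multiset.map_nsmul]

variable {r : ℕ} {T : Multiset ℕ}

open scoped Classical in
theorem PotentiallyGraphic.of_extend_zero
    (h : PotentiallyGraphic (⊤ : SimpleGraph (Fin (r + 1))) (extend T 0)) :
    PotentiallyGraphic (⊤ : SimpleGraph (Fin r)) T := by
  rw [← map_univ_extendDegree, potentiallyGraphic_map] at h
  obtain ⟨G, hdeg, hG⟩ := h
  obtain ⟨A, hA⟩ := exists_isNClique_of_top_isContained hG
  have hnone (v : T ⊕ (0 : Multiset ℕ)) : G.Adj none (some v) := by
    have hsub : G.neighborFinset none ⊆ univ.map .some := fun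
      | none => by simp
      | some _ => by simp
    have := eq_of_subset_of_card_le hsub
      (by simp [card_neighborFinset_eq_degree, hdeg, extendDegree])
    rw [← mem_neighborFinset, this]
    simp
  obtain ⟨B, hBA, hB⟩ : ∃ B ⊆ A.eraseNone, #B = r := by
    refine exists_subset_card_eq ?_
    rw [card_eraseNone_eq_card_erase]
    exact Nat.le_of_succ_le_succ
      (hA.card_eq.ge.trans (Nat.sub_le_iff_le_add.mp pred_card_le_card_erase))
  have hclique : (G.comap some).IsNClique r B := by
    refine ⟨fun a ha b hb hab => hA.isClique (mem_eraseNone.mp (hBA ha)) (mem_eraseNone.mp (hBA hb))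
      ((Option.some_injective _).ne hab), hB⟩
  rw [← add_zero T, ← map_univ_sumElim, potentiallyGraphic_map]
  refine ⟨G.comap some, ?_, (not_cliqueFree_iff_top_isContained r).mp hclique.not_cliqueFree⟩
  rintro (t | v)
  · simpa [hdeg, extendDegree, hnone] using (degree_some (G := G) rfl (.inl t)).symm
  · exact absurd (Multiset.coe_mem (x := v)) (Multiset.notMem_zero _)

theorem not_potentiallyGraphic_wheelLike {s j : ℕ} (hs : 3 < s) (hs' : s < 6) :
    ¬ PotentiallyGraphic (⊤ : SimpleGraph (Fin 4)) (wheelLike s j) := by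
  intro h
  rw [wheelLike_eq_extend] at h
  obtain ⟨A, hA, hcard, hge, hineq⟩ := h.of_extend_zero.exists_cliqueInequality
  obtain rfl : A = 3 • {2} := by
    rw [Multiset.nsmul_singleton, Multiset.eq_replicate]
    refine ⟨hcard, fun a ha => ?_⟩
    rcases Multiset.mem_add.mp (Multiset.mem_of_le hA ha) with h2 | h0
    · exact Multiset.mem_singleton.mp (Multiset.mem_of_mem_nsmul h2)
    · have ha0 := Multiset.mem_singleton.mp (Multiset.mem_of_mem_nsmul h0)
      exact absurd (hge a ha) (by simp [ha0])
  have hrest : s • {2} + j • {0} - 3 • {2} = (s - 3) • {2} + j • ({0} : Multiset ℕ) := by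
    nth_rw 1 [← Nat.sub_add_cancel hs.le]
    rw [add_nsmul, add_right_comm, add_tsub_cancel_right]
  have := hineq (0 < ·)
  rw [hrest] at this
  interval_cases s <;>
    simp [CliqueInequality, Multiset.filter_nsmul, Multiset.map_nsmul, Multiset.filter_singleton,
      Multiset.sum_nsmul] at this

theorem not_potentiallyGraphic_of_mem_sporadic {l : List ℕ} (hl : l ∈ sporadic) :
    ¬ PotentiallyGraphic (⊤ : SimpleGraph (Fin 4)) l := by
  have hcheck : ∀ l ∈ sporadic, ∀ A ∈ Multiset.powersetCard 4 (l : Multiset ℕ),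
      (∀ a ∈ A, 3 ≤ a) → ¬ CliqueInequality 4 A (l - A) (2 ≤ ·) := by
    decide +kernel
  intro h
  obtain ⟨A, hA, hcard, hge, hineq⟩ := h.exists_cliqueInequality
  exact hcheck l hl A (Multiset.mem_powersetCard.mpr ⟨hA, hcard⟩) hge (hineq _)

theorem Exceptional.not_potentiallyGraphic {M : Multiset ℕ} (hM : Exceptional M) :
    ¬ PotentiallyGraphic (⊤ : SimpleGraph (Fin 4)) M := by
  rcases hM with ⟨l, hl, rfl⟩ | ⟨j, rfl | rfl⟩
  · exact not_potentiallyGraphic_of_mem_sporadic hl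
  · exact not_potentiallyGraphic_wheelLike (by decide) (by decide)
  · exact not_potentiallyGraphic_wheelLike (by decide) (by decide)

end Exceptional

section LayOff

variable {T R : Multiset ℕ}

/-- The multiset `T + R` arises from `extend T R` by laying off a smallest term, which is
positive, to largest other terms. -/
structure IsLayOff (T R : Multiset ℕ) : Prop where
  ne_zero : T ≠ 0
  card_le_succ : ∀ t ∈ T, T.card ≤ t + 1
  card_le : ∀ r ∈ R, T.card ≤ r
  le_succ : ∀ t ∈ T, ∀ r ∈ R, r ≤ t + 1

theorem isLayOff_iff : IsLayOff T R ↔ T ≠ 0 ∧ (∀ t ∈ T, T.card ≤ t + 1) ∧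
    (∀ r ∈ R, T.card ≤ r) ∧ ∀ t ∈ T, ∀ r ∈ R, r ≤ t + 1 :=
  ⟨fun ⟨h₁, h₂, h₃, h₄⟩ => ⟨h₁, h₂, h₃, h₄⟩, fun ⟨h₁, h₂, h₃, h₄⟩ => ⟨h₁, h₂, h₃, h₄⟩⟩

instance : Decidable (IsLayOff T R) :=
  decidable_of_iff _ isLayOff_iff.symm

theorem exists_eq_add_card_eq (M : Multiset ℕ) {k : ℕ} (hk : k ≤ M.card) :
    ∃ T R : Multiset ℕ, M = T + R ∧ T.card = k ∧ ∀ t ∈ T, ∀ r ∈ R, r ≤ t := by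
  have hsort : (M.sort (· ≥ ·)).Pairwise (· ≥ ·) := M.pairwise_sort _
  rw [← List.take_append_drop k (M.sort _), List.pairwise_append] at hsort
  refine ⟨(M.sort (· ≥ ·)).take k, (M.sort (· ≥ ·)).drop k, ?_, ?_, hsort.2.2⟩
  · rw [Multiset.coe_add, List.take_append_drop, M.sort_eq]
  · rw [Multiset.coe_card, List.length_take, M.length_sort, min_eq_left hk]

theorem exists_eq_map_succ {M : Multiset ℕ} (hM : ∀ x ∈ M, 0 < x) :
    ∃ N : Multiset ℕ, M = N.map (· + 1) := by
  refine ⟨M.map Nat.pred, ?_⟩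
  rw [Multiset.map_map]
  exact (Multiset.map_id' M).symm.trans
    (Multiset.map_congr rfl fun x hx => (Nat.succ_pred_eq_of_pos (hM x hx)).symm)

theorem Graphic.exists_isLayOff {M : Multiset ℕ} (hM : Graphic M) (hne : M ≠ 0)
    (hpos : ∀ x ∈ M, 0 < x) : ∃ T R, M = extend T R ∧ IsLayOff T R := by
  obtain ⟨k, hk, hmin⟩ : ∃ k ∈ M, ∀ x ∈ M, k ≤ x := by
    simpa using M.toFinset.exists_min_image id (Multiset.toFinset_nonempty.mpr hne)
  obtain ⟨M', rfl⟩ := Multiset.exists_cons_of_mem hk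
  obtain ⟨T', R, rfl, hT, hTR⟩ := exists_eq_add_card_eq M' (k := k)
    (Nat.le_of_lt_succ (by simpa using hM.lt_card hk))
  obtain ⟨T, rfl⟩ := exists_eq_map_succ fun x (hx : x ∈ T') => hpos x (by simp [hx])
  rw [Multiset.card_map] at hT
  subst hT
  refine ⟨T, R, rfl, ?_, fun t ht => hmin _ ?_, fun r hr => hmin _ ?_, fun t ht => hTR _ ?_⟩
  · exact Multiset.card_pos.mp (hpos _ hk)
  · simp [ht]
  · simp [hr]
  · exact Multiset.mem_map_of_mem _ ht

end LayOff

section Constructions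

variable {W : Type*} {H : SimpleGraph W} {M : Multiset ℕ}

theorem PotentiallyGraphic.isolated_edge (h : PotentiallyGraphic H M) :
    PotentiallyGraphic H ({1} + ({1} + M)) := by
  have h₀ : PotentiallyGraphic H ({0} + M) := by
    simpa [DegreeSequence.extend] using potentiallyGraphic_extend (T := 0) (R := M) (by simpa)
  convert potentiallyGraphic_extend h₀ using 1
  simp only [DegreeSequence.extend, Multiset.card_singleton, Multiset.map_singleton, zero_add]

theorem PotentiallyGraphic.isolated_edges (h : PotentiallyGraphic H M) (m : ℕ) :
    PotentiallyGraphic H ((2 * m) • {1} + M) := by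
  induction m with
  | zero => simpa using h
  | succ m ih =>
    convert ih.isolated_edge using 1
    module

theorem PotentiallyGraphic.pendant_path (h : PotentiallyGraphic H ({1} + M)) (p : ℕ) :
    PotentiallyGraphic H ({1} + (p • {2} + M)) := by
  induction p with
  | zero => simpa using h
  | succ p ih =>
    convert potentiallyGraphic_extend ih using 1
    simp only [DegreeSequence.extend, Multiset.card_singleton, Multiset.map_singleton]
    module

theorem PotentiallyGraphic.cycle (h : PotentiallyGraphic H M) (p : ℕ) :
    PotentiallyGraphic H ((p + 3) • {2} + M) := by
  have hpath : PotentiallyGraphic H (2 • {1} + (p • {2} + M)) := by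
    rw [two_nsmul, add_assoc, add_left_comm {1} (p • {2})]
    exact h.isolated_edge.pendant_path p
  convert potentiallyGraphic_extend hpath using 1
  simp only [DegreeSequence.extend, Multiset.card_nsmul, Multiset.card_singleton,
    Multiset.map_nsmul, Multiset.map_singleton]
  module

theorem PotentiallyGraphic.ear {x : ℕ} (h : PotentiallyGraphic H ({x} + M)) (p : ℕ) :
    PotentiallyGraphic H ({x + 2} + ((p + 2) • {2} + M)) := by
  have hpath : PotentiallyGraphic H (({1} + {x + 1}) + (p • {2} + M)) := by
    convert (potentiallyGraphic_extend h).pendant_path p using 1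
    simp only [Multiset.map_singleton]
    module
  convert potentiallyGraphic_extend hpath using 1
  simp only [DegreeSequence.extend, Multiset.card_add, Multiset.card_singleton, Multiset.map_add,
    Multiset.map_singleton]
  module

theorem potentiallyGraphic_top_self (r : ℕ) :
    PotentiallyGraphic (⊤ : SimpleGraph (Fin r)) (r • {r - 1}) := by
  classical
  have hmap : r • ({r - 1} : Multiset ℕ) = univ.val.map fun _ : Fin r => r - 1 := by
    simp [Multiset.nsmul_singleton]
  rw [hmap, potentiallyGraphic_map]
  refine ⟨⊤, fun v => ?_, .refl _⟩
  convert complete_graph_degree v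
  rw [Fintype.card_fin]

end Constructions

section Search

/-- The list, in non-increasing order, that arises from `l` by lowering its first `j` terms by
one. -/
def lowerTop (j : ℕ) (l : List ℕ) : List ℕ :=
  ((l.take j).map Nat.pred ++ l.drop j).insertionSort (· ≥ ·)

/-- A search for a graph with degrees `c ++ l` whose vertices with degrees `c` form a clique: it
removes the other vertices one after the other, and tries, for each `j`, to make the removed vertex
adjacent to `j` vertices of largest degree in the clique and to vertices of largest degree
outside. The number of steps is the length of `l`. -/
def cliqueSearch : ℕ → List ℕ → List ℕ → Bool
  | 0, c, l => l.isEmpty && c.all (· == c.length - 1)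
  | _ + 1, _, [] => false
  | n + 1, c, k :: l => (List.range (k + 1)).any fun j =>
      (c.take j).countP (0 < ·) == j && (l.take (k - j)).countP (0 < ·) == k - j &&
        cliqueSearch n (lowerTop j c) (lowerTop (k - j) l)

theorem exists_lowerTop_eq {j : ℕ} {l : List ℕ} (hj : (l.take j).countP (0 < ·) = j) :
    ∃ T R : Multiset ℕ, T.card = j ∧ (l : Multiset ℕ) = T.map (· + 1) + R ∧
      (lowerTop j l : Multiset ℕ) = T + R := by
  have hlen : (l.take j).length = j :=
    (List.length_take_le j l).antisymm (hj.symm.trans_le List.countP_le_length)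
  have hpos : ∀ x ∈ l.take j, 0 < x := by
    simpa using List.countP_eq_length.mp (hj.trans hlen.symm)
  obtain ⟨T, hT⟩ := exists_eq_map_succ (M := l.take j) hpos
  refine ⟨T, l.drop j, ?_, ?_, ?_⟩
  · rw [← Multiset.card_map (· + 1), ← hT, Multiset.coe_card, hlen]
  · rw [← hT, Multiset.coe_add, List.take_append_drop]
  · have hpred : ((l.take j).map Nat.pred : Multiset ℕ) = T := by
      rw [← Multiset.map_coe, hT, Multiset.map_map]
      exact T.map_id'
    rw [lowerTop, Multiset.coe_eq_coe.mpr (List.perm_insertionSort _ _), ← Multiset.coe_add, hpred]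

theorem length_lowerTop (j : ℕ) (l : List ℕ) : (lowerTop j l).length = l.length := by
  rw [lowerTop, List.length_insertionSort, List.length_append, List.length_map,
    ← List.length_append, List.take_append_drop]

theorem potentiallyGraphic_of_cliqueSearch {n : ℕ} {c l : List ℕ} (h : cliqueSearch n c l) :
    PotentiallyGraphic (⊤ : SimpleGraph (Fin c.length)) (c + l : Multiset ℕ) := by
  induction n generalizing c l with
  | zero =>
    obtain ⟨rfl, hc⟩ : l = [] ∧ ∀ a ∈ c, a = c.length - 1 := by simpa [cliqueSearch] using h
    have hrep : (c : Multiset ℕ) = c.length • {c.length - 1} := by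
      rw [Multiset.nsmul_singleton]
      exact congrArg _ (List.eq_replicate_of_mem hc)
    rw [Multiset.coe_nil, add_zero, hrep]
    exact potentiallyGraphic_top_self c.length
  | succ n ih =>
    match l with
    | [] => simp [cliqueSearch] at h
    | k :: l =>
      obtain ⟨j, hj, hc, hl, hrec⟩ : ∃ j ≤ k, (c.take j).countP (0 < ·) = j ∧
          (l.take (k - j)).countP (0 < ·) = k - j ∧
            cliqueSearch n (lowerTop j c) (lowerTop (k - j) l) := by
        simpa [cliqueSearch, and_assoc, Nat.lt_succ_iff] using h
      obtain ⟨T, R, hT, hcTR, hTR⟩ := exists_lowerTop_eq hc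
      obtain ⟨T', R', hT', hlTR, hTR'⟩ := exists_lowerTop_eq hl
      have := ih hrec
      rw [length_lowerTop, hTR, hTR', add_add_add_comm] at this
      convert potentiallyGraphic_extend this using 1
      rw [← Multiset.cons_coe, hcTR, hlTR, extend, Multiset.card_add, hT, hT',
        Nat.add_sub_cancel' hj, Multiset.map_add, ← Multiset.singleton_add]
      abel

/-- The terms of `M` in non-increasing order. Unlike `Multiset.sort`, this evaluates in the
kernel. -/
def descendingList (M : Multiset ℕ) : List ℕ :=
  Quotient.liftOn M (List.insertionSort (· ≥ ·)) fun l l' (h : l.Perm l') =>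
    ((l.perm_insertionSort _).trans (h.trans (l'.perm_insertionSort _).symm)).eq_of_pairwise'
      (l.pairwise_insertionSort _) (l'.pairwise_insertionSort _)

theorem coe_descendingList (M : Multiset ℕ) : (descendingList M : Multiset ℕ) = M :=
  Quotient.inductionOn M fun l => Multiset.coe_eq_coe.mpr (l.perm_insertionSort _)

/-- A decidable condition on `M` which guarantees that `M` is exceptional or has a realization that
contains `K₄`. -/
def Settled (M : Multiset ℕ) : Prop :=
  (4 ≤ M.card ∧
      cliqueSearch (M.card - 4) ((descendingList M).take 4) ((descendingList M).drop 4)) ∨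
    (∃ l ∈ sporadic, M = l) ∨ ∃ j < 2, M = wheelLike 4 j ∨ M = wheelLike 5 j

instance {M : Multiset ℕ} : Decidable (Settled M) := by
  unfold Settled
  infer_instance

theorem Settled.potentiallyGraphic_or_exceptional {M : Multiset ℕ} (h : Settled M) :
    PotentiallyGraphic (⊤ : SimpleGraph (Fin 4)) M ∨ Exceptional M := by
  rcases h with ⟨hcard, h⟩ | h | ⟨j, -, h⟩
  · left
    have hlen : ((descendingList M).take 4).length = 4 := by
      rw [List.length_take, ← Multiset.coe_card, coe_descendingList, min_eq_left hcard]
    have := potentiallyGraphic_of_cliqueSearch h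
    rwa [hlen, Multiset.coe_add, List.take_append_drop, coe_descendingList] at this
  · exact .inr (.inl h)
  · exact .inr (.inr ⟨j, h⟩)

theorem settled_extend {T R : Multiset ℕ} {l : List ℕ} (hTR : T + R = l)
    (hl : l ∈ [4, 3, 3, 3, 3] :: [5, 3, 3, 3, 3, 3] :: sporadic) (h : IsLayOff T R)
    (hcount : 4 ≤ (extend T R).countP (3 ≤ ·)) : Settled (extend T R) := by
  have hcheck : ∀ l ∈ [4, 3, 3, 3, 3] :: [5, 3, 3, 3, 3, 3] :: sporadic, ∀ t ∈ l.sublists,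
      IsLayOff t (l - t) → 4 ≤ (extend t (l - t)).countP (3 ≤ ·) → Settled (extend t (l - t)) := by
    decide +kernel
  obtain ⟨t, ht, rfl⟩ : ∃ t ∈ l.sublists, (t : Multiset ℕ) = T := by
    simpa [Multiset.powerset_coe] using
      Multiset.mem_powerset.mpr ((Multiset.le_add_right T R).trans_eq hTR)
  obtain rfl : R = l - t := by rw [← hTR, add_tsub_cancel_left]
  exact hcheck l hl t ht h hcount

theorem settled_extend_three {x y z c : ℕ} (hc : c < 4)
    (hG : Graphic (extend {x, y, z} (c • {3}))) (h : IsLayOff {x, y, z} (c • {3})) :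
    Settled (extend {x, y, z} (c • {3})) := by
  have hcheck : ∀ c < 4, ∀ x y z : Fin (c + 3), IsLayOff {x.1, y.1, z.1} (c • {3}) →
      Even (extend {x.1, y.1, z.1} (c • {3})).sum → Settled (extend {x.1, y.1, z.1} (c • {3})) := by
    decide +kernel
  have hcard : (extend {x, y, z} (c • {3})).card = c + 4 := by
    simp [extend]
  have hlt (w : ℕ) (hw : w ∈ ({x, y, z} : Multiset ℕ)) : w < c + 3 := by
    have := hG.lt_card (x := w + 1) (by simp [extend, -Multiset.insert_eq_cons, hw])
    omega
  exact hcheck c hc ⟨x, hlt x (by simp)⟩ ⟨y, hlt y (by simp)⟩ ⟨z, hlt z (by simp)⟩ h hG.even_sum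

end Search

section LuoWarner

variable {T R M : Multiset ℕ}

theorem IsLayOff.extend_eq_wheelLike (h : IsLayOff T R) {s j : ℕ} (hs : 3 < s)
    (hTR : T + R = wheelLike s (j + 1)) : extend T R = wheelLike s (j + 2) := by
  have hmem {x : ℕ} : x ∈ T ∨ x ∈ R ↔ x = s + (j + 1) ∨ x = 3 ∨ x = 1 := by
    rw [← Multiset.mem_add, hTR]
    simp [wheelLike, (Nat.zero_lt_of_lt hs).ne']
  have hlarge : s < T.countP (3 ≤ ·) + R.countP (3 ≤ ·) := by
    rw [← Multiset.countP_add, hTR]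
    have h₃ : 3 ≤ s + (j + 1) := by omega
    simp [wheelLike, Multiset.countP_nsmul, ← Multiset.cons_zero, h₃]
  have h₁ : 1 ∈ R := by
    refine (hmem.mpr (by simp)).resolve_left fun h₁ => ?_
    have hR : R.countP (3 ≤ ·) = 0 := Multiset.countP_eq_zero.mpr fun r hr h₃ => by
      have := h.le_succ 1 h₁ r hr
      omega
    have := h.card_le_succ 1 h₁
    have := T.countP_le_card (3 ≤ ·)
    omega
  obtain ⟨t, rfl⟩ := Multiset.card_eq_one.mp
    ((h.card_le 1 h₁).antisymm (Multiset.card_pos.mpr h.ne_zero))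
  obtain rfl : t = s + (j + 1) := by
    rcases hmem.mpr (.inl rfl) with hT | hR
    · exact (Multiset.mem_singleton.mp hT).symm
    · have := h.le_succ t (by simp) _ hR
      have := hmem.mp (.inl (Multiset.mem_singleton_self t))
      omega
  rw [wheelLike, add_right_inj] at hTR
  rw [hTR]
  simp only [extend, wheelLike, Multiset.card_singleton, Multiset.map_singleton]
  module

theorem exists_eq_nsmul_add (hM : ∀ x ∈ M, 0 < x ∧ x ≤ 3) :
    ∃ c p q : ℕ, M = c • {3} + (p • {2} + q • {1}) := by
  refine ⟨M.count 3, M.count 2, M.count 1, Multiset.ext.mpr fun x => ?_⟩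
  by_cases hx : 0 < x ∧ x ≤ 3
  · obtain ⟨h₀, h₃⟩ := hx
    interval_cases x <;> simp
  · rw [Multiset.count_eq_zero_of_notMem fun h => hx (hM x h)]
    simp only [Multiset.count_add, Multiset.count_nsmul, Multiset.count_singleton]
    grind

theorem potentiallyGraphic_or_exceptional_of_four_threes {p q : ℕ}
    (hG : Graphic (4 • {3} + (p • {2} + q • {1}))) :
    PotentiallyGraphic (⊤ : SimpleGraph (Fin 4)) (4 • {3} + (p • {2} + q • {1})) ∨
      Exceptional (4 • {3} + (p • {2} + q • {1})) := by
  have hK₄ := potentiallyGraphic_top_self 4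
  obtain ⟨m, rfl⟩ : 2 ∣ q := by
    have := hG.even_sum
    simp only [Multiset.sum_add, Multiset.sum_nsmul, Multiset.sum_singleton, smul_eq_mul] at this
    grind
  obtain _ | m := m
  · obtain _ | _ | _ | p := p
    · exact .inl (by simpa using hK₄)
    · exact .inr (.inl ⟨[3, 3, 3, 3, 2], by decide, by decide⟩)
    · exact .inr (.inl ⟨[3, 3, 3, 3, 2, 2], by decide, by decide⟩)
    · refine .inl ?_
      convert hK₄.cycle p using 1
      module
  · refine .inl ?_
    have hedge : PotentiallyGraphic (⊤ : SimpleGraph (Fin 4))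
        ({1} + ({1} + ((2 * m) • {1} + 4 • {3}))) := (hK₄.isolated_edges m).isolated_edge
    convert hedge.pendant_path p using 1
    module

theorem potentiallyGraphic_top_four_ears {h p : ℕ} (hp : 2 * h ≤ p) :
    PotentiallyGraphic (⊤ : SimpleGraph (Fin 4)) ({2 * h + 5} + ((p + 2) • {2} + 3 • {3})) := by
  induction h generalizing p with
  | zero =>
    refine PotentiallyGraphic.ear (x := 3) ?_ p
    convert potentiallyGraphic_top_self 4 using 1
    module
  | succ h ih =>
    obtain ⟨p, rfl⟩ := Nat.exists_eq_add_of_le' (show 2 ≤ p by omega)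
    convert (ih (show 2 * h ≤ p by omega)).ear 0 using 1
    module

theorem potentiallyGraphic_of_three_threes {y p : ℕ} (hy : 3 ≤ y)
    (hG : Graphic ({y + 1} + (p • {2} + 3 • {3}))) :
    PotentiallyGraphic (⊤ : SimpleGraph (Fin 4)) ({y + 1} + (p • {2} + 3 • {3})) := by
  have hle : y ≤ p + 2 := by simpa using hG.lt_card (x := y + 1) (by simp)
  obtain ⟨h, rfl⟩ : ∃ h, y = 2 * h + 4 := by
    have := hG.even_sum
    simp only [Multiset.sum_add, Multiset.sum_nsmul, Multiset.sum_singleton, smul_eq_mul] at this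
    obtain ⟨k, hk⟩ := this
    exact ⟨k - p - 7, by omega⟩
  obtain ⟨p, rfl⟩ := Nat.exists_eq_add_of_le' (show 2 ≤ p by omega)
  exact potentiallyGraphic_top_four_ears (by omega)

theorem settled_extend_of_card_eq_three (hT : T.card = 3) (hG : Graphic (extend T R))
    (h : IsLayOff T R) (hlt : (T + R).countP (3 ≤ ·) < 4) : Settled (extend T R) := by
  rw [Multiset.countP_add] at hlt
  have hR : R.countP (3 ≤ ·) = R.card :=
    Multiset.countP_eq_card.mpr fun r hr => hT.symm.trans_le (h.card_le r hr)
  have hR₃ : ∀ r ∈ R, r = 3 := fun r hr => by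
    by_contra hne
    have hTcount : T.countP (3 ≤ ·) = 3 := hT ▸ Multiset.countP_eq_card.mpr fun t ht => by
      have := h.card_le r hr
      have := h.le_succ t ht r hr
      omega
    have := Multiset.card_pos_iff_exists_mem.mpr ⟨r, hr⟩
    omega
  obtain ⟨c, rfl⟩ : ∃ c, R = c • {3} :=
    ⟨R.card, by rw [Multiset.nsmul_singleton, ← Multiset.eq_replicate_card.mpr hR₃]⟩
  rw [Multiset.card_nsmul, Multiset.card_singleton, mul_one] at hR
  obtain ⟨x, y, z, rfl⟩ := Multiset.card_eq_three.mp hT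
  exact settled_extend_three (by omega) hG h

theorem two_mem_of_countP_lt (hT : T.card < 3)
    (hlt : (T + R).countP (3 ≤ ·) < (extend T R).countP (3 ≤ ·)) : 2 ∈ T := by
  by_contra h₂
  have hmap : (T.map (· + 1)).countP (3 ≤ ·) = T.countP (3 ≤ ·) := by
    rw [Multiset.countP_map, ← Multiset.countP_eq_card_filter]
    refine Multiset.countP_congr rfl fun t ht => ?_
    have : t ≠ 2 := fun h => h₂ (h ▸ ht)
    simp only [eq_iff_iff]
    omega
  have hcard : ({T.card} : Multiset ℕ).countP (3 ≤ ·) = 0 :=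
    Multiset.countP_eq_zero.mpr fun x hx => by
      rw [Multiset.mem_singleton.mp hx]
      exact hT.not_ge
  simp only [extend, Multiset.countP_add, hmap, hcard, zero_add, lt_self_iff_false] at hlt

theorem countP_three_le (c p q : ℕ) :
    (c • {3} + (p • {2} + q • {1}) : Multiset ℕ).countP (3 ≤ ·) = c := by
  simp [Multiset.countP_nsmul, ← Multiset.cons_zero]

theorem potentiallyGraphic_or_exceptional_of_pair {y c p : ℕ}
    (hG : Graphic (extend {2, y} (c • {3} + p • {2}))) (hy : c ≠ 0 → 2 ≤ y)
    (hlt : ({2, y} + (c • {3} + p • {2}) : Multiset ℕ).countP (3 ≤ ·) < 4)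
    (hcount : 4 ≤ (extend {2, y} (c • {3} + p • {2})).countP (3 ≤ ·)) :
    PotentiallyGraphic (⊤ : SimpleGraph (Fin 4)) (extend {2, y} (c • {3} + p • {2})) ∨
      Exceptional (extend {2, y} (c • {3} + p • {2})) := by
  have hM : extend {2, y} (c • {3} + p • {2}) = {y + 1} + ((p + 1) • {2} + (c + 1) • {3}) := by
    rw [Multiset.insert_eq_cons, ← Multiset.singleton_add]
    simp only [extend, Multiset.card_add, Multiset.card_singleton, Multiset.map_add,
      Multiset.map_singleton]
    module
  have hlt' : c + (if 3 ≤ y then 1 else 0) < 4 := by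
    simpa [Multiset.countP_nsmul, ← Multiset.cons_zero, Multiset.countP_cons] using hlt
  have hcount' : 4 ≤ c + 1 + if 2 ≤ y then 1 else 0 := by
    rw [hM] at hcount
    simpa [Multiset.countP_nsmul, ← Multiset.cons_zero, Multiset.countP_cons] using hcount
  have hy₂ : 2 ≤ y := hy (by grind)
  rw [hM] at hG ⊢
  obtain rfl : c = 2 := by
    have := hG.even_sum
    simp only [Multiset.sum_add, Multiset.sum_nsmul, Multiset.sum_singleton, smul_eq_mul] at this
    grind
  obtain rfl | hy₃ := hy₂.eq_or_lt
  · have hM' : ({2 + 1} + ((p + 1) • {2} + 3 • {3}) : Multiset ℕ) =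
        4 • {3} + ((p + 1) • {2} + 0 • {1}) := by
      module
    rw [hM'] at hG ⊢
    exact potentiallyGraphic_or_exceptional_of_four_threes hG
  · exact .inl (potentiallyGraphic_of_three_threes hy₃ hG)

theorem potentiallyGraphic_or_exceptional_of_two_mem (hG : Graphic (extend T R))
    (h : IsLayOff T R) (hT : T.card < 3) (h₂ : 2 ∈ T) (hlt : (T + R).countP (3 ≤ ·) < 4)
    (hcount : 4 ≤ (extend T R).countP (3 ≤ ·)) :
    PotentiallyGraphic (⊤ : SimpleGraph (Fin 4)) (extend T R) ∨ Exceptional (extend T R) := by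
  have hR (r : ℕ) (hr : r ∈ R) : 0 < r ∧ r ≤ 3 :=
    ⟨(Multiset.card_pos.mpr h.ne_zero).trans_le (h.card_le r hr), h.le_succ 2 h₂ r hr⟩
  obtain ⟨c, p, q, rfl⟩ := exists_eq_nsmul_add hR
  obtain ⟨T, rfl⟩ := Multiset.exists_cons_of_mem h₂
  obtain rfl | ⟨y, rfl⟩ : T = 0 ∨ ∃ y, T = {y} := by
    rw [← Multiset.card_eq_zero, ← Multiset.card_eq_one]
    rw [Multiset.card_cons] at hT
    omega
  · have hM : extend {2} (c • {3} + (p • {2} + q • {1})) =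
        (c + 1) • {3} + (p • {2} + (q + 1) • {1}) := by
      simp only [extend, Multiset.card_singleton, Multiset.map_singleton]
      module
    rw [Multiset.cons_zero] at *
    rw [Multiset.countP_add, countP_three_le] at hlt
    rw [hM, countP_three_le] at hcount
    obtain rfl : c = 3 := by omega
    rw [hM] at hG ⊢
    exact potentiallyGraphic_or_exceptional_of_four_threes hG
  · obtain rfl : q = 0 := by
      by_contra hq
      simpa using h.card_le 1 (by simp [hq])
    rw [zero_nsmul, add_zero] at *
    exact potentiallyGraphic_or_exceptional_of_pair hG
      (fun hc => by simpa using h.le_succ y (by simp) 3 (by simp [hc])) hlt hcount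

theorem potentiallyGraphic_or_exceptional_of_countP_lt (hG : Graphic (extend T R))
    (h : IsLayOff T R) (hlt : (T + R).countP (3 ≤ ·) < 4)
    (hcount : 4 ≤ (extend T R).countP (3 ≤ ·)) :
    PotentiallyGraphic (⊤ : SimpleGraph (Fin 4)) (extend T R) ∨ Exceptional (extend T R) := by
  have hcard : T.card < 4 := by
    by_contra! hcard
    have : T.countP (3 ≤ ·) = T.card := Multiset.countP_eq_card.mpr fun t ht => by
      have := h.card_le_succ t ht
      omega
    rw [Multiset.countP_add] at hlt
    omega
  obtain hT | hT : T.card = 3 ∨ T.card < 3 := by omega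
  · exact (settled_extend_of_card_eq_three hT hG h hlt).potentiallyGraphic_or_exceptional
  · exact potentiallyGraphic_or_exceptional_of_two_mem hG h hT
      (two_mem_of_countP_lt hT (hlt.trans_le hcount)) hlt hcount

theorem IsLayOff.pos_of_mem (h : IsLayOff T R) (hcount : 2 ≤ (T + R).countP (3 ≤ ·)) {x : ℕ}
    (hx : x ∈ T + R) : 0 < x := by
  rw [pos_iff_ne_zero]
  rintro rfl
  rcases Multiset.mem_add.mp hx with hT | hR
  · have hR : R.countP (3 ≤ ·) = 0 := Multiset.countP_eq_zero.mpr fun r hr h₃ => by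
      have := h.le_succ 0 hT r hr
      omega
    have := h.card_le_succ 0 hT
    have := T.countP_le_card (3 ≤ ·)
    rw [Multiset.countP_add] at hcount
    omega
  · exact h.ne_zero (Multiset.card_eq_zero.mp (Nat.le_zero.mp (h.card_le 0 hR)))

theorem potentiallyGraphic_or_exceptional (hG : Graphic M) (hpos : ∀ x ∈ M, 0 < x)
    (hcount : 4 ≤ M.countP (3 ≤ ·)) :
    PotentiallyGraphic (⊤ : SimpleGraph (Fin 4)) M ∨ Exceptional M := by
  induction hM : M.card generalizing M with
  | zero => simp [Multiset.card_eq_zero.mp hM] at hcount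
  | succ n ih =>
    obtain ⟨T, R, rfl, h⟩ := hG.exists_isLayOff (by rintro rfl; simp at hM) hpos
    by_cases hlt : (T + R).countP (3 ≤ ·) < 4
    · exact potentiallyGraphic_or_exceptional_of_countP_lt hG h hlt hcount
    have hcard : (T + R).card = n := by
      simpa [extend, add_comm 1] using hM
    rcases ih (hG.of_extend h.le_succ) (fun x hx => h.pos_of_mem (by omega) hx) (not_lt.mp hlt)
      hcard with hTR | ⟨l, hl, hTR⟩ | ⟨_ | j, hTR | hTR⟩
    · exact .inl (potentiallyGraphic_extend hTR)
    · exact (settled_extend hTR (by simp [hl]) h hcount).potentiallyGraphic_or_exceptional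
    · exact (settled_extend (l := [4, 3, 3, 3, 3]) hTR (by simp) h
        hcount).potentiallyGraphic_or_exceptional
    · exact (settled_extend (l := [5, 3, 3, 3, 3, 3]) hTR (by simp) h
        hcount).potentiallyGraphic_or_exceptional
    · exact .inr (.inr ⟨j + 2, .inl (h.extend_eq_wheelLike (by simp) hTR)⟩)
    · exact .inr (.inr ⟨j + 2, .inr (h.extend_eq_wheelLike (by simp) hTR)⟩)

theorem four_le_countP_of_potentiallyGraphic
    (h : PotentiallyGraphic (⊤ : SimpleGraph (Fin 4)) M) : 4 ≤ M.countP (3 ≤ ·) := by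
  obtain ⟨A, hAM, hA, hdeg, -⟩ := h.exists_cliqueInequality
  calc 4 = A.countP (3 ≤ ·) := by rw [Multiset.countP_eq_card.mpr hdeg, hA]
    _ ≤ M.countP (3 ≤ ·) := Multiset.countP_le_of_le _ hAM

theorem potentiallyGraphic_top_four_iff (hG : Graphic M) (hpos : ∀ x ∈ M, 0 < x) :
    PotentiallyGraphic (⊤ : SimpleGraph (Fin 4)) M ↔
      4 ≤ M.countP (3 ≤ ·) ∧ ¬Exceptional M :=
  ⟨fun h => ⟨four_le_countP_of_potentiallyGraphic h, fun hM => hM.not_potentiallyGraphic h⟩,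
    fun ⟨hcount, hM⟩ => (potentiallyGraphic_or_exceptional hG hpos hcount).resolve_right hM⟩

end LuoWarner

section Sequences

variable {n : ℕ} {d : Fin n → ℕ}

theorem isPotentiallyGraphic_iff {W : Type*} {H : SimpleGraph W} :
    IsPotentiallyGraphic H d ↔ PotentiallyGraphic H (univ.val.map d) := by
  rw [potentiallyGraphic_map]
  rfl

theorem lt_countP_iff (hd : Antitone d) (k : Fin n) (m : ℕ) :
    k < (univ.val.map d).countP (m ≤ ·) ↔ m ≤ d k := by
  rw [Multiset.countP_map, ← filter_val, ← card_def]
  constructor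
  · contrapose!
    refine fun hlt => (card_le_card (t := Iio k) fun i hi => ?_).trans (Fin.card_Iio k).le
    rw [mem_filter_univ] at hi
    exact mem_Iio.mpr (lt_of_not_ge fun hki => (hi.trans (hd hki)).not_gt hlt)
  · refine fun hle => Nat.lt_of_succ_le ((Fin.card_Iic k).ge.trans (card_le_card fun i hi => ?_))
    exact (mem_filter_univ i).mpr (hle.trans (hd (mem_Iic.mp hi)))

theorem map_univ_eq_coe_iff (hd : Antitone d) {l : List ℕ} (hl : l.Pairwise (· ≥ ·)) :
    univ.val.map d = l ↔ List.ofFn d = l := by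
  have hofFn : (List.ofFn d).Pairwise (· ≥ ·) := List.pairwise_ofFn.mpr fun _ _ hij => hd hij.le
  rw [Fin.univ_val_map, Multiset.coe_eq_coe]
  exact ⟨fun h => h.eq_of_pairwise' hofFn hl, .of_eq⟩

theorem exists_eq_wheelLike_iff (hd : Antitone d) {s : ℕ} (hs : 3 ≤ s) :
    (∃ j, univ.val.map d = wheelLike s j) ↔
      s < n ∧ List.ofFn d = (n - 1) :: (List.replicate s 3 ++ List.replicate (n - (s + 1)) 1) := by
  have hlist (j : ℕ) : univ.val.map d = wheelLike s j ↔
      List.ofFn d = (s + j) :: (List.replicate s 3 ++ List.replicate j 1) := by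
    rw [← map_univ_eq_coe_iff hd]
    · simp [wheelLike, Multiset.nsmul_singleton, ← Multiset.cons_coe, ← Multiset.coe_add,
        Multiset.coe_replicate]
    · rw [List.pairwise_cons, List.pairwise_append]
      grind
  constructor
  · rintro ⟨j, hj⟩
    obtain rfl : n = s + j + 1 := by simpa [wheelLike, add_comm 1] using congr_arg Multiset.card hj
    exact ⟨by omega, by simpa using (hlist j).mp hj⟩
  · rintro ⟨hsn, h⟩
    obtain ⟨j, rfl⟩ := Nat.exists_eq_add_of_lt hsn
    exact ⟨j, (hlist j).mpr (by simpa using h)⟩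

theorem ofFn_mem_sporadic_iff {i : Fin n} (hi : 4 ≤ d i) :
    List.ofFn d ∈ sporadic ↔ List.ofFn d ∈
      [[4, 4, 4, 4, 4, 4], [4, 4, 3, 3, 3, 3], [4, 3, 3, 3, 3, 2], [4, 4, 4, 4, 4, 4, 4],
        [4, 3, 3, 3, 3, 3, 3], [4, 3, 3, 3, 3, 3, 1]] := by
  have hfilter : sporadic.filter (∃ x ∈ ·, 4 ≤ x) =
      [[4, 4, 4, 4, 4, 4], [4, 4, 3, 3, 3, 3], [4, 3, 3, 3, 3, 2], [4, 4, 4, 4, 4, 4, 4],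
        [4, 3, 3, 3, 3, 3, 3], [4, 3, 3, 3, 3, 3, 1]] := by
    decide
  have hex : ∃ x ∈ List.ofFn d, 4 ≤ x := ⟨d i, List.mem_ofFn.mpr ⟨i, rfl⟩, hi⟩
  rw [← hfilter, List.mem_filter, decide_eq_true_eq, and_iff_left hex]

theorem exceptional_map_iff (hd : Antitone d) :
    Exceptional (univ.val.map d) ↔ List.ofFn d ∈ sporadic ∨
      (4 < n ∧ List.ofFn d = (n - 1) :: (List.replicate 4 3 ++ List.replicate (n - 5) 1)) ∨
      (5 < n ∧ List.ofFn d = (n - 1) :: (List.replicate 5 3 ++ List.replicate (n - 6) 1)) := by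
  have hsorted : ∀ l ∈ sporadic, l.Pairwise (· ≥ ·) := by decide
  have hsporadic : (∃ l ∈ sporadic, univ.val.map d = l) ↔ List.ofFn d ∈ sporadic := by
    refine (exists_congr fun l => and_congr_right fun hl =>
      map_univ_eq_coe_iff hd (hsorted l hl)).trans ?_
    simp
  rw [Exceptional, hsporadic, exists_or, exists_eq_wheelLike_iff hd (by simp),
    exists_eq_wheelLike_iff hd (by simp)]

end Sequences

end DegreeSequence

open DegreeSequence

theorem theorem3p4 (n : ℕ) (hn : 5 ≤ n) (d : Fin n → ℕ)
    (hmono : Antitone d) (hpos : ∀ i, 0 < d i) (hgraphic : IsGraphic d) :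
    IsPotentiallyGraphic K5MinusK13 d ↔
      (4 ≤ d ⟨0, by omega⟩ ∧ 3 ≤ d ⟨3, by omega⟩) ∧
      (List.ofFn d ≠ [4, 3, 3, 3, 3, 2] ∧
        List.ofFn d ≠ [4, 4, 4, 4, 4, 4] ∧
        List.ofFn d ≠ [4, 4, 3, 3, 3, 3] ∧
        List.ofFn d ≠ [4, 3, 3, 3, 3, 3, 3] ∧
        List.ofFn d ≠ [4, 4, 4, 4, 4, 4, 4] ∧
        List.ofFn d ≠ [4, 3, 3, 3, 3, 3, 1] ∧
        List.ofFn d ≠ (n - 1) :: (List.replicate 4 3 ++ List.replicate (n - 5) 1) ∧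
        (6 ≤ n →
          List.ofFn d ≠ (n - 1) :: (List.replicate 5 3 ++ List.replicate (n - 6) 1))) := by
  have hG : Graphic (Finset.univ.val.map d) :=
    isPotentiallyGraphic_iff.mp (hgraphic.imp fun _ h => ⟨h, .of_isEmpty⟩)
  have hfour : (∃ x ∈ Finset.univ.val.map d, 4 ≤ x) ↔ 4 ≤ d ⟨0, by omega⟩ := by
    rw [← lt_countP_iff hmono, Multiset.countP_pos]
  have hthree : 4 ≤ (Finset.univ.val.map d).countP (3 ≤ ·) ↔ 3 ≤ d ⟨3, by omega⟩ :=
    lt_countP_iff hmono ⟨3, by omega⟩ 3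
  rw [isPotentiallyGraphic_iff, potentiallyGraphic_K5MinusK13_iff,
    potentiallyGraphic_top_four_iff hG (by simpa using hpos), hfour, hthree,
    exceptional_map_iff hmono, and_right_comm, and_comm (a := 3 ≤ _)]
  refine and_congr_right fun h => ?_
  rw [ofFn_mem_sporadic_iff h.1]
  simp only [List.mem_cons, List.not_mem_nil]
  grind
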